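/- Let $X$ be a nonempty Hausdorff space. Let $\mathscr F(X)$ be the set of all nonempty closed subsets of $X$, endowed with the Vietoris topology, i.e. the topology generated by the sets $\{S\in\mathscr F(X): S\subset\bigcup\mathscr V$ and $S\cap V\ne\emptyset$ for all $V\in\mathscr V\}$, where $\mathscr V$ runs over the finite families of open subsets of $X$. A continuous selection for $\mathscr F(X)$ is a continuous map $f:\mathscr F(X)\to X$ with $f(S)\in S$ for every $S\in\mathscr F(X)$. A point $p\in X$ is a cut point of $X$ if there are subsets $U,V\subset X$ with $X\setminus\{p\}=U\cup V$ and $\overline U\cap\overline V=\{p\}$. A point $p\in X$ is countably-approachable if it is either isolated or has a countable local base of clopen subsets of the subspace $\overline U$ for some open set $U\subset X\setminus\{p\}$ with $\overline U=U\cup\{p\}$. Put $$X_\Theta=\{f(X): f \text{ is a continuous selection for } \mathscr F(X)\},\qquad X_\Omega=\{p\in X: p\text{ is countably-approachable}\}.$$ Theorem. If $\mathscr F(X)$ has at least one continuous selection, then $$X_\Omega=\{p\in X_\Theta: p\text{ is either isolated or a cut point of } X\}.$$ In particular, every cut point $p\in X_\Theta$ has a countable clopen base in $\overline U$ for some open set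 $U\subset X\setminus\{p\}$ with $\overline U=U\cup\{p\}$. -/

import Mathlib

open Set Topology

/-- The set `F(X)` of all nonempty closed subsets of a topological space `X`. -/
def VietorisHyperspace (X : Type*) [TopologicalSpace X] : Type _ :=
  {S : Set X // IsClosed S ∧ S.Nonempty}

namespace VietorisHyperspace

/-- The Vietoris topology on `F(X)`: the subspace topology induced by Mathlib's Vietoris topology
on the power set, which is generated by the sets `{S | S ⊆ U}` and `{S | (S ∩ U).Nonempty}` for
open `U`. -/
instance (X : Type*) [TopologicalSpace X] : TopologicalSpace (VietorisHyperspace X) :=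
  TopologicalSpace.induced Subtype.val (TopologicalSpace.vietoris X)

/-- The whole space, as a point of its hyperspace. -/
def whole (X : Type*) [TopologicalSpace X] [Nonempty X] : VietorisHyperspace X :=
  ⟨Set.univ, isClosed_univ, Set.univ_nonempty⟩

end VietorisHyperspace

/-- `f` is a continuous selection for the Vietoris hyperspace `F(X)`. -/
def IsContinuousSelection {X : Type*} [TopologicalSpace X] (f : VietorisHyperspace X → X) : Prop :=
  Continuous f ∧ ∀ S : VietorisHyperspace X, f S ∈ S.1

/-- `p` is a cut point of the (arbitrary) space `X`: there are subsets `U`, `V` of `X` with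
`X \ {p} = U ∪ V` and `closure U ∩ closure V = {p}`. -/
def IsCutPoint {X : Type*} [TopologicalSpace X] (p : X) : Prop :=
  ∃ U V : Set X, ({p}ᶜ : Set X) = U ∪ V ∧ closure U ∩ closure V = {p}

/-- `p` is an isolated point of `X`. -/
def IsIsolatedPoint {X : Type*} [TopologicalSpace X] (p : X) : Prop :=
  IsOpen ({p} : Set X)

/-- The point `y` of the space `Y` has a countable local base consisting of clopen sets of `Y`. -/
def HasCountableClopenBase {Y : Type*} [TopologicalSpace Y] (y : Y) : Prop :=
  ∃ B : Set (Set Y), B.Countable ∧ (∀ W ∈ B, IsClopen W ∧ y ∈ W) ∧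
    ∀ O : Set Y, IsOpen O → y ∈ O → ∃ W ∈ B, W ⊆ O

/-- There is an open set `U ⊆ X \ {p}` with `closure U = U ∪ {p}` such that `p` has a countable
clopen base in the subspace `closure U`. -/
def IsOmegaApproachable {X : Type*} [TopologicalSpace X] (p : X) : Prop :=
  ∃ U : Set X, IsOpen U ∧ U ⊆ {p}ᶜ ∧ closure U = U ∪ {p} ∧
    ∃ hp : p ∈ closure U, HasCountableClopenBase (⟨p, hp⟩ : closure U)

/-- The set `X_Θ` of all points of the form `f(X)` for a continuous selection `f` for `F(X)`. -/
def selectionPoints (X : Type*) [TopologicalSpace X] [Nonempty X] : Set X :=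
  {p | ∃ f : VietorisHyperspace X → X,
    IsContinuousSelection f ∧ f (VietorisHyperspace.whole X) = p}

/-- The set `X_Ω` of all countably-approachable points of `X`. -/
def countablyApproachablePoints (X : Type*) [TopologicalSpace X] : Set X :=
  {p | IsIsolatedPoint p ∨ IsOmegaApproachable p}

/-! ### Selections and the Vietoris topology. -/

section SetSelection

attribute [local instance] TopologicalSpace.vietoris

/-! Everything passes through `IsClopenLimit`: nonempty clopen sets missing `p` that converge to
`p`. For non-isolated approachability this is a reformulation. Such a sequence makes `p` a cut point
(put every other term on one side) and allows any selection to be modified so that it sends `univ`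
to `p`.

The hard part is that a cut point `p = F univ` is a clopen limit. Continuity at `univ` says that `F
S` is near `p` once `S` contains a suitable finite set. Call a clopen `D'` missing `p` good if `F
(D'ᶜ ∪ {y}) = y` for some `y ∈ D'`. If good sets can always be found disjoint from a given clopen
set missing `p`, a disjoint sequence of them yields the clopen limit, since complements of its late
members contain any given finite set.

Otherwise some clopen `D` missing `p` is absorbing: `F` takes values in the quasi-component `Q` of
`p` on all closed sets containing `Q ∪ D`. The relation `F (D ∪ {a, b}) = a` on `Q` then has `F (D ∪
Q)` as a minimum. If `Q ≠ {p}`, the cut keeps these minima away from `p` and allows at most one on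
each side, although they approach `p` as `D` grows; hence `Q = {p}`. Finally, an increasing sequence
of clopen sets whose selected points alternate between the two sides of the cut has a limit with
selected point `p`, and this produces the required clopen sets. -/

/-- A selection for the nonempty closed subsets of `X`, given as a total function on `Set X` whose
values off the nonempty closed sets are irrelevant, continuous for the Vietoris topology. -/
structure IsSetSelection {X : Type*} [TopologicalSpace X] (F : Set X → X) : Prop where
  mem : ∀ S : Set X, IsClosed S → S.Nonempty → F S ∈ S
  eventually_mem : ∀ S : Set X, IsClosed S → S.Nonempty → ∀ O : Set X, IsOpen O → F S ∈ O →
    ∀ᶠ S' in 𝓝 S, IsClosed S' → S'.Nonempty → F S' ∈ O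

variable {X : Type*} [TopologicalSpace X]

theorem VietorisHyperspace.eventually_nhds_iff {S : VietorisHyperspace X}
    {P : VietorisHyperspace X → Prop} :
    (∀ᶠ T in 𝓝 S, P T) ↔ ∀ᶠ S' in 𝓝 S.1, ∀ T : VietorisHyperspace X, T.1 = S' → P T := by
  have h : 𝓝 S = Filter.comap (fun T : VietorisHyperspace X => T.1) (𝓝 S.1) :=
    nhds_induced _ _
  rw [h]
  exact Filter.eventually_comap

theorem IsContinuousSelection.exists_isSetSelection [Nonempty X] {f : VietorisHyperspace X → X}
    (hf : IsContinuousSelection f) :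
    ∃ F : Set X → X, IsSetSelection F ∧ F univ = f (VietorisHyperspace.whole X) := by
  classical
  refine ⟨fun S => if h : IsClosed S ∧ S.Nonempty then f ⟨S, h⟩ else Classical.arbitrary X,
    ⟨?_, ?_⟩, ?_⟩
  · intro S hS hne
    simpa [hS, hne] using hf.2 ⟨S, hS, hne⟩
  · intro S hS hne O hO hFO
    have h : ∀ᶠ T in 𝓝 (⟨S, hS, hne⟩ : VietorisHyperspace X), f T ∈ O :=
      hf.1.continuousAt.eventually_mem (hO.mem_nhds (by simpa [hS, hne] using hFO))
    filter_upwards [VietorisHyperspace.eventually_nhds_iff.1 h] with S' h' hS' hne'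
    simpa [hS', hne'] using h' ⟨S', hS', hne'⟩ rfl
  · simp [VietorisHyperspace.whole, isClosed_univ, univ_nonempty]

theorem IsSetSelection.isContinuousSelection {F : Set X → X} (hF : IsSetSelection F) :
    IsContinuousSelection (fun S : VietorisHyperspace X => F S.1) := by
  refine ⟨continuous_iff_continuousAt.2 fun S => ?_, fun S => hF.mem _ S.2.1 S.2.2⟩
  rw [ContinuousAt, (nhds_basis_opens (F S.1)).tendsto_right_iff]
  rintro O ⟨hFO, hO⟩
  rw [VietorisHyperspace.eventually_nhds_iff]
  filter_upwards [hF.eventually_mem _ S.2.1 S.2.2 O hO hFO] with S' h T hT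
  subst hT
  exact h T.2.1 T.2.2

theorem continuous_vietoris_of_forall {Y : Type*} [TopologicalSpace Y] {g : Y → Set X}
    (h₁ : ∀ O, IsOpen O → IsOpen {y | g y ⊆ O})
    (h₂ : ∀ O, IsOpen O → IsOpen {y | (g y ∩ O).Nonempty}) : Continuous g := by
  refine continuous_generateFrom_iff.2 ?_
  rintro _ (⟨O, hO, rfl⟩ | ⟨O, hO, rfl⟩)
  · exact h₁ O hO
  · exact h₂ O hO

theorem continuous_union_singleton (S : Set X) : Continuous fun x : X => S ∪ {x} := by
  refine continuous_vietoris_of_forall (fun O hO => ?_) (fun O hO => ?_)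
  · simp only [union_subset_iff, singleton_subset_iff]
    exact isOpen_const.inter hO
  · simp only [union_inter_distrib_right, union_nonempty, singleton_inter_nonempty]
    exact isOpen_const.union hO

theorem IsClopen.continuous_inter {K : Set X} (hK : IsClopen K) :
    Continuous fun S : Set X => S ∩ K := by
  refine continuous_vietoris_of_forall (fun O hO => ?_) (fun O hO => ?_)
  · have : {S : Set X | S ∩ K ⊆ O} = (O ∪ Kᶜ).powerset := by
      ext S
      simp only [mem_ofPred_eq, mem_powerset_iff]
      constructor
      · intro h x hx
        by_cases hxK : x ∈ K
        · exact Or.inl (h ⟨hx, hxK⟩)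
        · exact Or.inr hxK
      · rintro h x ⟨hx, hxK⟩
        exact (h hx).resolve_right (fun h => h hxK)
    rw [this]
    exact (hO.union hK.1.isOpen_compl).powerset_vietoris
  · simp only [inter_assoc]
    exact TopologicalSpace.vietoris.isOpen_inter_nonempty_of_isOpen (hK.2.inter hO)

theorem IsClopen.isClopen_setOf_inter_nonempty {K : Set X} (hK : IsClopen K) :
    IsClopen {S : Set X | (S ∩ K).Nonempty} :=
  ⟨TopologicalSpace.vietoris.isClosed_inter_nonempty_of_isClosed hK.1,
    TopologicalSpace.vietoris.isOpen_inter_nonempty_of_isOpen hK.2⟩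

namespace IsSetSelection

variable {F : Set X → X}

/-- A set `S = closure M` is approximated by the sets between a finite subset of `M` and `S`. -/
theorem exists_finite_of_closure (hF : IsSetSelection F) {M O : Set X} (hM : M.Nonempty)
    (hO : IsOpen O) (hFO : F (closure M) ∈ O) :
    ∃ T : Set X, T.Finite ∧ T ⊆ M ∧
      ∀ S, IsClosed S → T ⊆ S → S ⊆ closure M → S.Nonempty → F S ∈ O := by
  obtain ⟨W, ⟨u, ⟨hu, huo⟩, rfl⟩, hSW, hW⟩ :=
    TopologicalSpace.vietoris.isTopologicalBasis.mem_nhds_iff.1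
      (hF.eventually_mem _ isClosed_closure hM.closure O hO hFO)
  have key : ∀ U ∈ u, (M ∩ U).Nonempty := fun U hU => by
    obtain ⟨x, hx, hxU⟩ := hSW.2 U hU
    obtain ⟨y, hyU, hyM⟩ := mem_closure_iff.1 hx U (huo U hU) hxU
    exact ⟨y, hyM, hyU⟩
  have : Nonempty X := ⟨hM.some⟩
  choose! t ht using key
  refine ⟨t '' u, hu.image t, ?_, fun S hS hTS hSM hne => ?_⟩
  · rintro _ ⟨U, hU, rfl⟩
    exact (ht U hU).1
  · exact hW ⟨hSM.trans hSW.1, fun U hU => ⟨t U, hTS ⟨U, hU, rfl⟩, (ht U hU).2⟩⟩ hS hne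

theorem exists_finite (hF : IsSetSelection F) {S O : Set X} (hS : IsClosed S) (hne : S.Nonempty)
    (hO : IsOpen O) (hFO : F S ∈ O) :
    ∃ T : Set X, T.Finite ∧ T ⊆ S ∧
      ∀ S', IsClosed S' → T ⊆ S' → S' ⊆ S → S'.Nonempty → F S' ∈ O := by
  simpa only [hS.closure_eq] using hF.exists_finite_of_closure hne hO (by rwa [hS.closure_eq])

/-- Finitely many points force the values at closed sets containing them to be near `F univ`. -/
theorem exists_finite_of_univ (hF : IsSetSelection F) {p : X} (hp : F univ = p)
    {O : Set X}
    (hO : IsOpen O) (hpO : p ∈ O) :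
    ∃ T : Set X, T.Finite ∧ ∀ S, IsClosed S → T ⊆ S → S.Nonempty → F S ∈ O := by
  obtain ⟨T, hT, -, h⟩ := hF.exists_finite isClosed_univ ⟨p, trivial⟩ hO (by rwa [hp])
  exact ⟨T, hT, fun S hS hTS hne => h S hS hTS (subset_univ S) hne⟩

theorem continuous_union_singleton [T1Space X] (hF : IsSetSelection F) {S : Set X}
    (hS : IsClosed S) : Continuous fun x => F (S ∪ {x}) := by
  refine continuous_iff_continuousAt.2 fun x => ?_
  rw [ContinuousAt, (nhds_basis_opens _).tendsto_right_iff]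
  rintro O ⟨hFO, hO⟩
  have hc (y : X) : IsClosed (S ∪ {y}) := hS.union isClosed_singleton
  have hn (y : X) : (S ∪ {y}).Nonempty := ⟨y, by simp⟩
  filter_upwards [(_root_.continuous_union_singleton S).continuousAt.eventually
    (hF.eventually_mem _ (hc x) (hn x) O hO hFO)] with y hy
  exact hy (hc y) (hn y)

theorem mem_of_union_singleton [T1Space X] (hF : IsSetSelection F) {S : Set X}
    (hS : IsClosed S) (x : X) : F (S ∪ {x}) = x ∨ F (S ∪ {x}) ∈ S := by
  have := hF.mem (S ∪ {x}) (hS.union isClosed_singleton) ⟨x, by simp⟩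
  simpa [or_comm] using this

/-- Among the closed sets `K` with `F (K ∪ E)` in a clopen set there is a clopen one. -/
theorem exists_isClopen [T1Space X] (hF : IsSetSelection F) {W R K₀ E : Set X} (hW : IsClopen W)
    (hR : IsClopen R) (hE : IsClosed E) (hK₀ : IsClosed K₀) (hK₀W : K₀ ⊆ W)
    (h : F (K₀ ∪ E) ∈ R) :
    ∃ K, IsClopen K ∧ K₀ ⊆ K ∧ K ⊆ W ∧ F (K ∪ E) ∈ R := by
  -- Zorn on closed sets: the closure of the union of a chain is a Vietoris limit of its members, so
  -- closedness of `R` bounds chains.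
  obtain ⟨K, hK₀K, hK⟩ := zorn_subset_nonempty {K | IsClosed K ∧ K ⊆ W ∧ F (K ∪ E) ∈ R}
    (fun c hc hch hcne => by
      refine ⟨closure (⋃₀ c), ⟨isClosed_closure,
        hW.1.closure_subset_iff.2 (sUnion_subset fun s hs => (hc hs).2.1), ?_⟩,
        fun s hs => (subset_sUnion_of_mem hs).trans subset_closure⟩
      have hcl : closure (⋃₀ c ∪ E) = closure (⋃₀ c) ∪ E := by
        rw [closure_union, hE.closure_eq]
      by_cases hU : (⋃₀ c ∪ E).Nonempty
      swap
      · obtain ⟨s, hs⟩ := hcne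
        have h1 : ⋃₀ c ∪ E = ∅ := not_nonempty_iff_eq_empty.1 hU
        have h2 : s = ∅ := subset_empty_iff.1
          (((subset_sUnion_of_mem hs).trans subset_union_left).trans h1.subset)
        have h3 : ⋃₀ c = ∅ := subset_empty_iff.1 (subset_union_left.trans h1.subset)
        have := (hc hs).2.2
        rw [h2] at this
        simpa [h3] using this
      by_contra hn
      rw [← hcl] at hn
      obtain ⟨T, hT, hTU, hTF⟩ := hF.exists_finite_of_closure hU hR.1.isOpen_compl hn
      obtain ⟨x, hx⟩ := hU
      obtain ⟨s, hs, hTs⟩ : ∃ s ∈ c, insert x T ⊆ s ∪ E := by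
        have hd : DirectedOn (· ⊆ ·) ((fun s => s ∪ E) '' c) := by
          rintro _ ⟨a, ha, rfl⟩ _ ⟨b, hb, rfl⟩
          rcases hch.total ha hb with hab | hab
          · exact ⟨_, ⟨b, hb, rfl⟩, union_subset_union_left _ hab, subset_rfl⟩
          · exact ⟨_, ⟨a, ha, rfl⟩, subset_rfl, union_subset_union_left _ hab⟩
        obtain ⟨_, ⟨s, hs, rfl⟩, h⟩ := hd.exists_mem_subset_of_finite_of_subset_sUnion
          (hcne.image _) (hT.insert x) (by
            intro y hy
            rcases insert_subset hx hTU hy with ⟨s, hs, hxs⟩ | hxE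
            · exact ⟨_, ⟨s, hs, rfl⟩, Or.inl hxs⟩
            · obtain ⟨s, hs⟩ := hcne
              exact ⟨_, ⟨s, hs, rfl⟩, Or.inr hxE⟩)
        exact ⟨s, hs, h⟩
      have hsE : s ∪ E ⊆ closure (⋃₀ c ∪ E) :=
        (union_subset_union_left _ (subset_sUnion_of_mem hs)).trans subset_closure
      exact hTF _ ((hc hs).1.union hE) ((subset_insert _ _).trans hTs) hsE
        ⟨x, hTs (mem_insert _ _)⟩ (hc hs).2.2) K₀ ⟨hK₀, hK₀W, h⟩
  refine ⟨K, ⟨hK.prop.1, ?_⟩, hK₀K, hK.prop.2.1, hK.prop.2.2⟩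
  -- Adding a point close to `k` keeps the value in the open set `R`, so by maximality that point
  -- already lies in `K`.
  rw [isOpen_iff_mem_nhds]
  intro k hk
  have hk' : K ∪ E ∪ {k} = K ∪ E := by
    rw [union_eq_self_of_subset_right]
    exact singleton_subset_iff.2 (Or.inl hk)
  filter_upwards [hW.2.mem_nhds (hK.prop.2.1 hk),
    (hF.continuous_union_singleton (hK.prop.1.union hE)).continuousAt.eventually_mem
      (hR.2.mem_nhds (by rw [hk']; exact hK.prop.2.2))] with y hyW hy
  refine hK.le_of_ge (y := K ∪ {y}) ⟨hK.prop.1.union isClosed_singleton,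
    union_subset hK.prop.2.1 (singleton_subset_iff.2 hyW), ?_⟩ subset_union_left (by simp)
  rwa [union_right_comm]

end IsSetSelection

end SetSelection

/-! ### Clopen limits: approachability, cut points and modified selections. -/

section ClopenLimit

variable {X : Type*} [TopologicalSpace X]

/-- Some sequence of nonempty clopen sets missing `p` converges to `p`. -/
def IsClopenLimit (p : X) : Prop :=
  ∃ L : ℕ → Set X, (∀ n, IsClopen (L n) ∧ (L n).Nonempty ∧ p ∉ L n) ∧
    ∀ O, IsOpen O → p ∈ O → ∀ᶠ n in Filter.atTop, L n ⊆ O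

theorem mem_closure_iUnion_of_eventually_subset {p : X} {L : ℕ → Set X}
    (hne : ∀ n, (L n).Nonempty)
    (hL : ∀ O, IsOpen O → p ∈ O → ∀ᶠ n in Filter.atTop, L n ⊆ O) : p ∈ closure (⋃ n, L n) := by
  refine mem_closure_iff.2 fun O hO hp => ?_
  obtain ⟨n, hn⟩ := (hL O hO hp).exists
  obtain ⟨x, hx⟩ := hne n
  exact ⟨x, hn hx, mem_iUnion.2 ⟨n, hx⟩⟩

theorem closure_iUnion_eq_union_singleton [T2Space X] {p : X} {L : ℕ → Set X}
    (hL : ∀ n, IsClopen (L n)) (hne : ∀ n, (L n).Nonempty)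
    (hlim : ∀ O, IsOpen O → p ∈ O → ∀ᶠ n in Filter.atTop, L n ⊆ O) :
    closure (⋃ n, L n) = (⋃ n, L n) ∪ {p} := by
  refine Subset.antisymm (fun x hx => ?_) (union_subset subset_closure
    (singleton_subset_iff.2 (mem_closure_iUnion_of_eventually_subset hne hlim)))
  by_contra hn
  simp only [mem_union, mem_iUnion, mem_singleton_iff, not_or, not_exists] at hn
  obtain ⟨A, B, hA, hB, hxA, hpB, hAB⟩ := t2_separation hn.2
  obtain ⟨N, hN⟩ := Filter.eventually_atTop.1 (hlim B hB hpB)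
  have hC : IsClosed (⋃ n ∈ Finset.range N, L n) :=
    isClosed_biUnion_finset fun n _ => (hL n).1
  obtain ⟨y, ⟨hyA, hyC⟩, hy⟩ := mem_closure_iff.1 hx (A ∩ (⋃ n ∈ Finset.range N, L n)ᶜ)
    (hA.inter hC.isOpen_compl) ⟨hxA, by simpa using fun n _ => hn.1 n⟩
  obtain ⟨n, hn⟩ := mem_iUnion.1 hy
  by_cases hnN : n < N
  · exact hyC (mem_biUnion (by simpa using hnN) hn)
  · exact disjoint_left.1 hAB hyA (hN n (not_lt.1 hnN) hn)

theorem IsClopenLimit.isOmegaApproachable [T2Space X] {p : X} (h : IsClopenLimit p) :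
    IsOmegaApproachable p := by
  obtain ⟨L, hL, hlim⟩ := h
  have hcl := closure_iUnion_eq_union_singleton (fun n => (hL n).1) (fun n => (hL n).2.1) hlim
  have hp : p ∈ closure (⋃ n, L n) := by simp [hcl]
  refine ⟨⋃ n, L n, isOpen_iUnion fun n => (hL n).1.2, fun x hx hxp => ?_, hcl, hp, ?_⟩
  · obtain ⟨n, hn⟩ := mem_iUnion.1 hx
    exact (hL n).2.2 ((mem_singleton_iff.1 hxp) ▸ hn)
  · refine ⟨range fun N : ℕ => Subtype.val ⁻¹' (⋃ n ∈ Finset.range N, L n)ᶜ,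
      countable_range _, ?_, ?_⟩
    · rintro _ ⟨N, rfl⟩
      refine ⟨(isClopen_biUnion_finset fun n _ => (hL n).1).compl.preimage
        continuous_subtype_val, ?_⟩
      simpa using fun n _ => (hL n).2.2
    · intro O hO hpO
      obtain ⟨O', hO', rfl⟩ := isOpen_induced_iff.1 hO
      obtain ⟨N, hN⟩ := Filter.eventually_atTop.1 (hlim O' hO' hpO)
      refine ⟨_, ⟨N, rfl⟩, ?_⟩
      rintro ⟨x, hx⟩ hxN
      rw [hcl] at hx
      rcases hx with hx | rfl
      · obtain ⟨n, hn⟩ := mem_iUnion.1 hx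
        by_cases hnN : n < N
        · exact absurd (mem_biUnion (by simpa using hnN) hn) hxN
        · exact hN n (not_lt.1 hnN) hn
      · exact hpO

theorem IsOmegaApproachable.isClopenLimit [T2Space X] {p : X} (h : IsOmegaApproachable p) :
    IsClopenLimit p := by
  obtain ⟨U, hU, hUp, hcl, hp, B, hB, hBc, hBb⟩ := h
  have hpU : p ∉ U := fun h => hUp h rfl
  obtain ⟨W₀, hW₀, -⟩ := hBb univ isOpen_univ trivial
  obtain ⟨W, rfl⟩ := hB.exists_eq_range ⟨W₀, hW₀⟩
  set H : ℕ → Set (closure U) := fun n => ⋂ i ∈ Finset.range (n + 1), W i with hH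
  have hHc (n : ℕ) : IsClopen (H n) :=
    isClopen_biInter_finset fun i _ => (hBc _ ⟨i, rfl⟩).1
  have hHp (n : ℕ) : ⟨p, hp⟩ ∈ H n := mem_iInter₂.2 fun i _ => (hBc _ ⟨i, rfl⟩).2
  have hHW (n : ℕ) : H n ⊆ W n := biInter_subset_of_mem (by simp)
  have hanti : Antitone H := fun m n hmn => biInter_subset_biInter_left fun i hi => by
    simp only [Finset.coe_range, mem_Iio] at hi ⊢
    omega
  have key (n : ℕ) : ∃ L : Set X, IsClopen L ∧ L.Nonempty ∧ p ∉ L ∧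
      ∀ x (hx : x ∈ L), ∃ h : x ∈ closure U, ⟨x, h⟩ ∈ H n := by
    obtain ⟨O, hO, hOH⟩ := isOpen_induced_iff.1 (hHc n).2
    obtain ⟨u, huO, huU⟩ := mem_closure_iff.1 hp O hO (by
      have := hHp n
      rwa [← hOH] at this)
    obtain ⟨V, hV, huV⟩ : ∃ V : Set (closure U), V ∈ range W ∧ ⟨u, subset_closure huU⟩ ∉ V := by
      have hne : (⟨p, hp⟩ : closure U) ≠ ⟨u, subset_closure huU⟩ := by
        rintro h
        have hpu : p = u := congrArg Subtype.val h
        exact hpU (hpu ▸ huU)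
      obtain ⟨V, hV, hVs⟩ := hBb {⟨u, subset_closure huU⟩}ᶜ isOpen_compl_singleton hne
      exact ⟨V, hV, fun h => hVs h rfl⟩
    obtain ⟨m, rfl⟩ := hV
    -- This difference misses `p`, hence lies in `U`: it is closed in `X` because `closure U` is,
    -- and open in `X` because `U` is.
    have hD : IsClopen (H n \ W m) := (hHc n).diff (hBc _ ⟨m, rfl⟩).1
    have hsub : Subtype.val '' (H n \ W m) ⊆ U := by
      rintro _ ⟨⟨x, hx⟩, hxD, rfl⟩
      rcases hcl ▸ hx with h | h
      · exact h
      · obtain rfl : x = p := h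
        exact absurd (hBc _ ⟨m, rfl⟩).2 hxD.2
    refine ⟨Subtype.val '' (H n \ W m), ⟨?_, ?_⟩, ?_, fun h => hpU (hsub h), ?_⟩
    · exact isClosed_closure.isClosedMap_subtype_val _ hD.1
    · obtain ⟨O', hO', hOD⟩ := isOpen_induced_iff.1 hD.2
      have : Subtype.val '' (H n \ W m) = O' ∩ U := by
        refine Subset.antisymm (fun x hx => ⟨?_, hsub hx⟩) fun x hx => ?_
        · obtain ⟨y, hy, rfl⟩ := hx
          rw [← hOD] at hy
          exact hy
        · refine ⟨⟨x, subset_closure hx.2⟩, ?_, rfl⟩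
          rw [← hOD]
          exact hx.1
      rw [this]
      exact hO'.inter hU
    · refine ⟨u, ⟨u, subset_closure huU⟩, ⟨?_, huV⟩, rfl⟩
      rw [← hOH]
      exact huO
    · rintro _ ⟨⟨x, hx⟩, hxD, rfl⟩
      exact ⟨hx, hxD.1⟩
  choose L hL using key
  refine ⟨L, fun n => ⟨(hL n).1, (hL n).2.1, (hL n).2.2.1⟩, fun O hO hpO => ?_⟩
  obtain ⟨_, ⟨m, rfl⟩, hm⟩ := hBb (Subtype.val ⁻¹' O) (hO.preimage continuous_subtype_val) hpO
  filter_upwards [Filter.eventually_ge_atTop m] with n hn x hx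
  obtain ⟨hxU, hxH⟩ := (hL n).2.2.2 x hx
  exact hm (hHW m (hanti hn hxH))

theorem IsClopenLimit.exists_pairwise_disjoint {p : X} (h : IsClopenLimit p) :
    ∃ L : ℕ → Set X, (∀ n, IsClopen (L n) ∧ (L n).Nonempty ∧ p ∉ L n) ∧
      Pairwise (Function.onFun Disjoint L) ∧
      ∀ O, IsOpen O → p ∈ O → ∀ᶠ n in Filter.atTop, L n ⊆ O := by
  obtain ⟨L, hL, hlim⟩ := h
  obtain ⟨φ, -, hφ⟩ := exists_seq_of_forall_finset_exists (fun _ : ℕ => True)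
    (fun m n => m < n ∧ Disjoint (L m) (L n)) (fun s _ => by
      have h1 : ∀ᶠ n in Filter.atTop, ∀ m ∈ s, m < n ∧ Disjoint (L m) (L n) := by
        refine (Filter.eventually_all_finset s).2 fun m _ => (Filter.eventually_gt_atTop m).and ?_
        filter_upwards [hlim _ (hL m).1.1.isOpen_compl (hL m).2.2] with n hn
        exact (subset_compl_iff_disjoint_left.1 hn)
      obtain ⟨n, hn⟩ := h1.exists
      exact ⟨n, trivial, hn⟩)
  have hmono : StrictMono φ := fun m n hmn => (hφ m n hmn).1
  refine ⟨L ∘ φ, fun n => hL _, fun m n hmn => ?_, fun O hO hp =>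
    hmono.tendsto_atTop.eventually (hlim O hO hp)⟩
  rcases hmn.lt_or_gt with h | h
  · exact (hφ m n h).2
  · exact (hφ n m h).2.symm

/-- With disjoint terms, the even ones form `U`; the odd ones make the rest accumulate at `p` too.
-/
theorem IsClopenLimit.isCutPoint [T2Space X] {p : X} (h : IsClopenLimit p) : IsCutPoint p := by
  obtain ⟨L, hL, hdisj, hlim⟩ := h.exists_pairwise_disjoint
  have hev {φ : ℕ → ℕ} (hφ : StrictMono φ) (O : Set X) (hO : IsOpen O) (hp : p ∈ O) :
      ∀ᶠ n in Filter.atTop, L (φ n) ⊆ O := hφ.tendsto_atTop.eventually (hlim O hO hp)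
  have he : StrictMono fun n : ℕ => 2 * n := fun m n h => by simpa using h
  have ho : StrictMono fun n : ℕ => 2 * n + 1 := fun m n h => by simpa using h
  set U : Set X := ⋃ n, L (2 * n) with hU
  have hUo : IsOpen U := isOpen_iUnion fun n => (hL _).1.2
  have hpU : p ∉ U := by simpa [hU] using fun n => (hL (2 * n)).2.2
  have hcl : closure U = U ∪ {p} :=
    closure_iUnion_eq_union_singleton (fun n => (hL _).1) (fun n => (hL _).2.1) (hev he)
  refine ⟨U, (U ∪ {p})ᶜ, ?_, ?_⟩
  · ext x
    simp only [mem_compl_iff, mem_singleton_iff, mem_union]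
    constructor
    · intro h
      by_cases hx : x ∈ U <;> simp [hx, h]
    · rintro (hx | hx) rfl
      · exact hpU hx
      · simp at hx
  · refine Subset.antisymm (fun x hx => ?_) (singleton_subset_iff.2 ⟨by simp [hcl], ?_⟩)
    · rw [hcl] at hx
      refine hx.1.resolve_left fun hxU => ?_
      obtain ⟨y, hy, hy'⟩ := mem_closure_iff.1 hx.2 U hUo hxU
      exact hy' (Or.inl hy)
    · refine closure_mono ?_ (mem_closure_iUnion_of_eventually_subset (fun n => (hL _).2.1)
        (hev ho))
      rintro x hx (hxU | rfl)
      · obtain ⟨n, hn⟩ := mem_iUnion.1 hx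
        obtain ⟨m, hm⟩ := mem_iUnion.1 hxU
        exact disjoint_left.1 (hdisj (show 2 * n + 1 ≠ 2 * m by omega)) hn hm
      · obtain ⟨n, hn⟩ := mem_iUnion.1 hx
        exact (hL _).2.2 hn

attribute [local instance] TopologicalSpace.vietoris

theorem IsIsolatedPoint.exists_isSetSelection [T1Space X] {p : X} (hp : IsIsolatedPoint p)
    {F : Set X → X} (hF : IsSetSelection F) :
    ∃ G : Set X → X, IsSetSelection G ∧ G univ = p := by
  classical
  have hpc : IsClopen {S : Set X | (S ∩ {p}).Nonempty} :=
    IsClopen.isClopen_setOf_inter_nonempty ⟨isClosed_singleton, hp⟩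
  refine ⟨fun S => if (S ∩ {p}).Nonempty then p else F S, ⟨fun S hS hne => ?_,
    fun S hS hne O hO hSO => ?_⟩, by simp⟩
  · split_ifs with h
    · simpa using h
    · exact hF.mem S hS hne
  · by_cases h : (S ∩ {p}).Nonempty
    · filter_upwards [hpc.2.mem_nhds h] with S' hS' _ _
      rw [if_pos (show (S' ∩ {p}).Nonempty from hS')]
      rwa [if_pos h] at hSO
    · rw [if_neg h] at hSO
      filter_upwards [hpc.1.isOpen_compl.mem_nhds h, hF.eventually_mem S hS hne O hO hSO]
        with S' hS' hS'O hc hn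
      rw [if_neg (show ¬ (S' ∩ {p}).Nonempty from hS')]
      exact hS'O hc hn

theorem IsClopenLimit.exists_isSetSelection [T2Space X] {p : X} (hp : IsClopenLimit p)
    {F : Set X → X} (hF : IsSetSelection F) :
    ∃ G : Set X → X, IsSetSelection G ∧ G univ = p := by
  classical
  obtain ⟨L, hL, hlim⟩ := hp
  -- `S` is sent to `p` if it meets all `L n`; else it is cut down to the last `L n` before the
  -- first one that it misses.
  let K : ℕ → Set X := fun n => n.casesOn univ L
  have hK (n : ℕ) : IsClopen (K n) := by
    cases n
    exacts [isClopen_univ, (hL _).1]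
  have hKS {n : ℕ} {S : Set X} (hne : S.Nonempty) (h : ∀ m < n, (S ∩ L m).Nonempty) :
      (S ∩ K n).Nonempty := by
    cases n with
    | zero => simpa [K] using hne
    | succ n => exact h n (Nat.lt_succ_self n)
  let G : Set X → X := fun S =>
    if h : ∃ n, ¬ (S ∩ L n).Nonempty then F (S ∩ K (Nat.find h)) else p
  have hG {S : Set X} {n : ℕ} (hn : ¬ (S ∩ L n).Nonempty) (h : ∀ m < n, (S ∩ L m).Nonempty) :
      G S = F (S ∩ K n) := by
    have hex : ∃ n, ¬ (S ∩ L n).Nonempty := ⟨n, hn⟩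
    have : Nat.find hex = n := (Nat.find_eq_iff hex).2 ⟨hn, fun m hm => not_not.2 (h m hm)⟩
    simp only [G, dif_pos hex, this]
  have hGp {S : Set X} (h : ∀ n, (S ∩ L n).Nonempty) : G S = p := by
    have hex : ¬ ∃ n, ¬ (S ∩ L n).Nonempty := by simpa using h
    simp only [G, dif_neg hex]
  have hcases (S : Set X) : (∀ n, (S ∩ L n).Nonempty) ∨
      ∃ n, ¬ (S ∩ L n).Nonempty ∧ ∀ m < n, (S ∩ L m).Nonempty := by
    by_cases hex : ∃ n, ¬ (S ∩ L n).Nonempty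
    · exact Or.inr ⟨Nat.find hex, Nat.find_spec hex, fun m hm => not_not.1 (Nat.find_min hex hm)⟩
    · exact Or.inl (by simpa using hex)
  have hopen (n : ℕ) : IsOpen {S : Set X | ∀ m < n, (S ∩ L m).Nonempty} := by
    have : {S : Set X | ∀ m < n, (S ∩ L m).Nonempty} =
        ⋂ m ∈ Finset.range n, {S : Set X | (S ∩ L m).Nonempty} := by
      ext S
      simp
    rw [this]
    exact isOpen_biInter_finset fun m _ => (hL m).1.isClopen_setOf_inter_nonempty.2
  refine ⟨G, ⟨fun S hS hne => ?_, fun S hS hne O hO hSO => ?_⟩, hGp fun n => by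
    simpa using (hL n).2.1⟩
  · rcases hcases S with h | ⟨n, hn, h⟩
    · rw [hGp h, ← hS.closure_eq]
      refine closure_mono (iUnion_subset fun n => inter_subset_left (t := L n))
        (mem_closure_iUnion_of_eventually_subset h fun O hO hpO => ?_)
      filter_upwards [hlim O hO hpO] with n hn
      exact inter_subset_right.trans hn
    · rw [hG hn h]
      exact (hF.mem _ (hS.inter (hK n).1) (hKS hne h)).1
  · rcases hcases S with h | ⟨n, hn, h⟩
    · rw [hGp h] at hSO
      obtain ⟨N, hN⟩ := Filter.eventually_atTop.1 (hlim O hO hSO)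
      -- Meeting `L 0, ..., L N` makes the first missed index exceed `N`, so `S'` is cut down to
      -- some `L m` with `m ≥ N`, inside `O`.
      filter_upwards [(hopen (N + 1)).mem_nhds fun m _ => h m] with S' hS' hc hne'
      rcases hcases S' with h' | ⟨n, hn, h'⟩
      · rwa [hGp h']
      · rw [hG hn h']
        have hNn : N < n := by
          by_contra hle
          exact hn (hS' n (by omega))
        obtain ⟨m, rfl⟩ : ∃ m, n = m + 1 := ⟨n - 1, by omega⟩
        exact hN m (by omega) (hF.mem _ (hc.inter (hK _).1) (hKS hne' h')).2
    · rw [hG hn h] at hSO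
      have hev := (hK n).continuous_inter.continuousAt.eventually
        (hF.eventually_mem _ (hS.inter (hK n).1) (hKS hne h) O hO hSO)
      filter_upwards [hev, (hopen n).mem_nhds h,
        (hL n).1.isClopen_setOf_inter_nonempty.1.isOpen_compl.mem_nhds hn] with S' h1 h2 h3 hc hne'
      rw [hG h3 h2]
      exact h1 (hc.inter (hK n).1) (hKS hne' h2)

end ClopenLimit

/-! ### Quasi-components. -/

section QuasiComponent

variable {X : Type*} [TopologicalSpace X]

/-- The quasi-component of `p`: the intersection of all clopen sets containing `p`. -/
def quasiComponent (p : X) : Set X :=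
  {x | ∀ K, IsClopen K → p ∈ K → x ∈ K}

theorem mem_quasiComponent_self (p : X) : p ∈ quasiComponent p := fun _ _ h => h

theorem isClosed_quasiComponent (p : X) : IsClosed (quasiComponent p) := by
  have : quasiComponent p = ⋂₀ {K | IsClopen K ∧ p ∈ K} := by
    ext x
    simp [quasiComponent]
  rw [this]
  exact isClosed_sInter fun K hK => hK.1.1

variable {p : X}

theorem IsClopen.mem_iff_of_mem_quasiComponent {K : Set X} (hK : IsClopen K) {x : X}
    (hx : x ∈ quasiComponent p) : x ∈ K ↔ p ∈ K :=
  ⟨fun h => by_contra fun hp => hx _ hK.compl hp h, fun h => hx K hK h⟩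

theorem IsClopen.disjoint_quasiComponent {K : Set X} (hK : IsClopen K) (hp : p ∉ K) :
    Disjoint K (quasiComponent p) :=
  disjoint_left.2 fun _ h hx => hp ((hK.mem_iff_of_mem_quasiComponent hx).1 h)

theorem IsClopen.quasiComponent_subset {K : Set X} (hK : IsClopen K) {x : X}
    (hx : x ∈ quasiComponent p) (hxK : x ∈ K) : quasiComponent p ⊆ K :=
  fun _ hy => (hK.mem_iff_of_mem_quasiComponent hy).2
    ((hK.mem_iff_of_mem_quasiComponent hx).1 hxK)

theorem exists_isClopen_of_notMem_quasiComponent {x : X} (hx : x ∉ quasiComponent p) :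
    ∃ K, IsClopen K ∧ p ∉ K ∧ x ∈ K := by
  simp only [quasiComponent, mem_ofPred_eq, not_forall] at hx
  obtain ⟨K, hK, hp, hx⟩ := hx
  exact ⟨Kᶜ, hK.compl, not_not.2 hp, hx⟩

theorem exists_isClopen_of_finite {T : Set X} (hT : T.Finite)
    (hTQ : Disjoint T (quasiComponent p)) : ∃ K, IsClopen K ∧ p ∉ K ∧ T ⊆ K := by
  induction T, hT using Set.Finite.induction_on with
  | empty => exact ⟨∅, isClopen_empty, notMem_empty p, subset_rfl⟩
  | @insert a T _ _ ih =>
    obtain ⟨K, hK, hpK, hTK⟩ := ih (hTQ.mono_left (subset_insert a T))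
    obtain ⟨E, hE, hpE, haE⟩ := exists_isClopen_of_notMem_quasiComponent
      (disjoint_left.1 hTQ (mem_insert a T))
    exact ⟨K ∪ E, hK.union hE, by simp [hpK, hpE],
      insert_subset (Or.inr haE) (hTK.trans subset_union_left)⟩

theorem exists_isClopen_union_finite {D T : Set X} (hD : IsClopen D) (hpD : p ∉ D)
    (hT : T.Finite) : ∃ D', IsClopen D' ∧ p ∉ D' ∧ D ⊆ D' ∧ T ⊆ quasiComponent p ∪ D' := by
  obtain ⟨E, hE, hpE, hTE⟩ := exists_isClopen_of_finite (p := p)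
    (hT.subset (sdiff_subset (t := quasiComponent p))) disjoint_sdiff_left
  refine ⟨D ∪ E, hD.union hE, by simp [hpD, hpE], subset_union_left, fun x hx => ?_⟩
  by_cases hxQ : x ∈ quasiComponent p
  · exact Or.inl hxQ
  · exact Or.inr (Or.inr (hTE ⟨hx, hxQ⟩))

end QuasiComponent

/-! ### The dichotomy: disjoint good sets or absorption. -/

namespace IsSetSelection

variable {X : Type*} [TopologicalSpace X] [T2Space X] {F : Set X → X} {p : X}

/-- Openness: `F S ∉ D` keeps such a `y` out of `S`, so for `x` near `y` the value at `S ∪ {x}`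
avoids the closed set `S` and can only be `x`. -/
theorem isClopen_setOf_eq (hF : IsSetSelection F) {S D : Set X} (hS : IsClosed S)
    (hD : IsClopen D) (hFS : F S ∉ D) : IsClopen {y ∈ D | F (S ∪ {y}) = y} := by
  have hc := hF.continuous_union_singleton hS
  refine ⟨hD.1.inter (isClosed_eq hc continuous_id), ?_⟩
  rw [isOpen_iff_mem_nhds]
  rintro y ⟨hyD, hy⟩
  have hyS : y ∉ S := fun h => hFS (by
    rw [union_eq_self_of_subset_right (singleton_subset_iff.2 h)] at hy
    rwa [hy])
  filter_upwards [hD.2.mem_nhds hyD,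
    hc.continuousAt.eventually_mem (hS.isOpen_compl.mem_nhds (by rwa [hy]))] with x hxD hx
  exact ⟨hxD, (hF.mem_of_union_singleton hS x).resolve_right hx⟩

theorem eventually_eq_of_isolated (hF : IsSetSelection F) {S : Set X} {v x : X} (hS : IsClosed S)
    (hSv : IsClosed (S \ {v})) (hxv : x ≠ v) (hx : F (S ∪ {x}) = v) :
    ∀ᶠ y in 𝓝 x, F (S ∪ {y}) = v := by
  obtain ⟨A, B, hA, hB, hxA, hvB, hAB⟩ := t2_separation hxv
  filter_upwards [hA.mem_nhds hxA,
    (hF.continuous_union_singleton hS).continuousAt.eventually_mem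
      ((hB.inter hSv.isOpen_compl).mem_nhds (by rw [hx]; exact ⟨hvB, by simp⟩))] with y hyA hy
  rcases hF.mem_of_union_singleton hS y with h | h
  · rw [h] at hy
    exact absurd hy.1 (disjoint_left.1 hAB hyA)
  · by_contra hne
    exact hy.2 ⟨h, hne⟩

theorem isClopenLimit_of_forall_exists (hF : IsSetSelection F) (hp : F univ = p)
    (h : ∀ D, IsClopen D → p ∉ D → ∃ D', IsClopen D' ∧ p ∉ D' ∧ Disjoint D D' ∧
      ∃ y ∈ D', F (D'ᶜ ∪ {y}) = y) : IsClopenLimit p := by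
  obtain ⟨D, hD, hdisj⟩ := exists_seq_of_forall_finset_exists
    (fun D : Set X => IsClopen D ∧ p ∉ D ∧ ∃ y ∈ D, F (Dᶜ ∪ {y}) = y) Disjoint (fun s hs => by
      obtain ⟨D', h1, h2, h3, h4⟩ := h (⋃ D ∈ s, D) (isClopen_biUnion_finset fun D hD => (hs D hD).1)
        (by simpa using fun D hD => (hs D hD).2.1)
      exact ⟨D', ⟨h1, h2, h4⟩, fun D hD => h3.mono_left (subset_biUnion_of_mem (u := id) hD)⟩)
  have hmem (n : ℕ) : F (D n)ᶜ ∉ D n :=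
    hF.mem _ (hD n).1.compl.1 ⟨p, (hD n).2.1⟩
  refine ⟨fun n => {y ∈ D n | F ((D n)ᶜ ∪ {y}) = y}, fun n =>
    ⟨hF.isClopen_setOf_eq (hD n).1.compl.1 (hD n).1 (hmem n), (hD n).2.2,
      fun hp => (hD n).2.1 hp.1⟩, fun O hO hpO => ?_⟩
  obtain ⟨T, hT, hTO⟩ := hF.exists_finite_of_univ hp hO hpO
  -- By disjointness each point of `T` lies in at most one `D n`.
  have hev : ∀ᶠ n in Filter.atTop, ∀ t ∈ T, t ∉ D n := by
    refine (Filter.eventually_all_finite hT).2 fun t _ => ?_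
    by_cases ht : ∃ m, t ∈ D m
    · obtain ⟨m, hm⟩ := ht
      filter_upwards [Filter.eventually_gt_atTop m] with n hn
      exact disjoint_left.1 (hdisj m n hn) hm
    · exact Filter.Eventually.of_forall fun n hn => ht ⟨n, hn⟩
  filter_upwards [hev] with n hn
  rintro y ⟨-, hy⟩
  rw [← hy]
  exact hTO _ ((hD n).1.compl.1.union isClosed_singleton) (fun t ht => Or.inl (hn t ht))
    ⟨y, by simp⟩

/-- If the selected point were some `t ∈ T`, remove it and enlarge the remaining set to a clopen `K`
with `F (K ∪ {t}) = t`; then `Kᶜ` contradicts `hbad`. -/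
theorem mem_of_finite_of_forall_ne (hF : IsSetSelection F) {D : Set X} (hD : IsClopen D)
    (hbad : ∀ D', IsClopen D' → p ∉ D' → Disjoint D D' → ∀ y ∈ D',
      F (D'ᶜ ∪ {y}) ≠ y) (T : Finset X) :
    Disjoint (T : Set X) (quasiComponent p ∪ D) →
      F (quasiComponent p ∪ D ∪ T) ∈ quasiComponent p ∪ D := by
  classical
  induction T using Finset.strongInduction with
  | H T ih =>
  intro hT
  by_contra hn
  have hQD : IsClosed (quasiComponent p ∪ D) := (isClosed_quasiComponent p).union hD.1
  have hpQ : p ∈ quasiComponent p ∪ D := Or.inl (mem_quasiComponent_self p)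
  set t := F (quasiComponent p ∪ D ∪ T) with ht
  have htT : t ∈ T := (hF.mem _ (hQD.union T.finite_toSet.isClosed) ⟨p, Or.inl hpQ⟩).resolve_left hn
  have herase := ih (T.erase t) (Finset.erase_ssubset htT)
    (hT.mono_left (by simp))
  obtain ⟨E, hE, hpE, hTE⟩ := exists_isClopen_of_finite (p := p) T.finite_toSet
    (hT.mono_right subset_union_left)
  set S : Set X := quasiComponent p ∪ D ∪ (T.erase t : Finset X) with hS_def
  have hS : IsClosed S := hQD.union (T.erase t).finite_toSet.isClosed
  have hSt : S ∪ {t} = quasiComponent p ∪ D ∪ T := by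
    rw [hS_def, union_assoc, union_singleton, ← Finset.coe_insert, Finset.insert_erase htT]
  have hED : IsClopen (E \ D) := hE.diff hD
  have hFS : F S ∉ E \ D := fun h => by
    rcases herase with hQ | hD
    · exact disjoint_left.1 (hE.disjoint_quasiComponent hpE) h.1 hQ
    · exact h.2 hD
  have hR := hF.isClopen_setOf_eq hS hED hFS
  set R : Set X := {y ∈ E \ D | F (S ∪ {y}) = y} with hR_def
  have htR : t ∈ R := ⟨⟨hTE htT, fun h => disjoint_left.1 hT htT (Or.inr h)⟩, by rw [hSt]⟩
  have hSR : S ⊆ Rᶜ := by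
    rintro x hx ⟨hxE, hxF⟩
    rw [union_eq_self_of_subset_right (singleton_subset_iff.2 hx)] at hxF
    exact hFS (hxF ▸ hxE)
  obtain ⟨K, hK, hSK, hKR, hFK⟩ := hF.exists_isClopen hR.compl hR isClosed_singleton hS hSR
    (E := {t}) (by rw [hSt]; exact htR)
  have hFt : F (K ∪ {t}) = t :=
    (hF.mem_of_union_singleton hK.1 t).resolve_right fun h => hKR h hFK
  refine hbad Kᶜ hK.compl (not_not.2 (hSK (Or.inl hpQ)))
    (disjoint_compl_right_iff_subset.2 ((subset_union_right.trans subset_union_left).trans hSK))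
    t (fun h => hKR h htR) ?_
  rwa [compl_compl]

theorem mem_of_forall_ne (hF : IsSetSelection F) {D : Set X} (hD : IsClopen D)
    (hbad : ∀ D', IsClopen D' → p ∉ D' → Disjoint D D' → ∀ y ∈ D',
      F (D'ᶜ ∪ {y}) ≠ y) {S : Set X} (hS : IsClosed S) (hQS : quasiComponent p ∪ D ⊆ S) :
    F S ∈ quasiComponent p ∪ D := by
  classical
  by_contra hn
  have hQD : IsClosed (quasiComponent p ∪ D) := (isClosed_quasiComponent p).union hD.1
  have hpQ : p ∈ quasiComponent p ∪ D := Or.inl (mem_quasiComponent_self p)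
  obtain ⟨T, hT, hTS, h⟩ := hF.exists_finite hS ⟨p, hQS hpQ⟩ hQD.isOpen_compl hn
  have hT' : (T \ (quasiComponent p ∪ D)).Finite := hT.subset sdiff_subset
  have := hF.mem_of_finite_of_forall_ne hD hbad hT'.toFinset
    (by rw [hT'.coe_toFinset]; exact disjoint_sdiff_left)
  rw [hT'.coe_toFinset, union_sdiff_self] at this
  exact h _ (hQD.union hT.isClosed) subset_union_right (union_subset hQS hTS) ⟨p, Or.inl hpQ⟩ this

/-- Values in `D` are excluded by adding to `D` a clopen set that captures the finitely many points
forcing `F S` near `p`, hence outside `D`. -/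
theorem exists_forall_mem_quasiComponent (hF : IsSetSelection F) (hp : F univ = p) {D : Set X}
    (hD : IsClopen D) (hpD : p ∉ D) (hbad : ∀ D', IsClopen D' → p ∉ D' → Disjoint D D' →
      ∀ y ∈ D', F (D'ᶜ ∪ {y}) ≠ y) :
    ∃ D₁, IsClopen D₁ ∧ p ∉ D₁ ∧
      ∀ S, IsClosed S → quasiComponent p ∪ D₁ ⊆ S → F S ∈ quasiComponent p := by
  obtain ⟨T, hT, hTF⟩ := hF.exists_finite_of_univ hp hD.compl.2 hpD
  obtain ⟨D₁, hD₁, hpD₁, hDD₁, hTD₁⟩ := exists_isClopen_union_finite hD hpD hT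
  refine ⟨D₁, hD₁, hpD₁, fun S hS hQS => ?_⟩
  exact (hF.mem_of_forall_ne hD hbad hS
    ((union_subset_union_right _ hDD₁).trans hQS)).resolve_right
    (hTF S hS (hTD₁.trans hQS) ⟨p, hQS (Or.inl (mem_quasiComponent_self p))⟩)

end IsSetSelection

/-! ### Absorbing sets and the induced relation on the quasi-component. -/

/-- `D` is a clopen set missing `p` such that `F` selects points of the quasi-component of `p` from
all closed sets containing `D` and this quasi-component. -/
structure IsAbsorbing {X : Type*} [TopologicalSpace X] (F : Set X → X) (p : X) (D : Set X) :
    Prop where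
  isClopen : IsClopen D
  notMem : p ∉ D
  mem : ∀ S, IsClosed S → quasiComponent p ∪ D ⊆ S → F S ∈ quasiComponent p

namespace IsAbsorbing

variable {X : Type*} [TopologicalSpace X] {F : Set X → X} {p : X} {D D' : Set X}

theorem mono (h : IsAbsorbing F p D) (hD' : IsClopen D') (hp : p ∉ D') (hDD' : D ⊆ D') :
    IsAbsorbing F p D' :=
  ⟨hD', hp, fun S hS hDS => h.mem S hS ((union_subset_union_right _ hDD').trans hDS)⟩

theorem disjoint (h : IsAbsorbing F p D) : Disjoint D (quasiComponent p) :=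
  h.isClopen.disjoint_quasiComponent h.notMem

theorem apply_eq (hD : IsAbsorbing F p D) (hQ : quasiComponent p = {p}) {S : Set X}
    (hS : IsClosed S) (hDS : D ⊆ S) (hpS : p ∈ S) : F S = p := by
  have := hD.mem S hS (union_subset (by simpa [hQ] using hpS) hDS)
  rwa [hQ] at this

/-- A value in the clopen `D` would persist on a clopen enlargement, which contains the whole
quasi-component and so contradicts absorption. -/
theorem notMem_of_inter_nonempty [T1Space X] (h : IsAbsorbing F p D) (hF : IsSetSelection F)
    {K : Set X} (hK : IsClosed K) (hKQ : (K ∩ quasiComponent p).Nonempty) : F (D ∪ K) ∉ D := by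
  intro hD
  obtain ⟨x, hxK, hxQ⟩ := hKQ
  obtain ⟨K', hK', hKK', -, hFK'⟩ := hF.exists_isClopen isClopen_univ h.isClopen isClosed_empty
    (h.isClopen.1.union hK) (subset_univ _) (by rwa [union_empty])
  rw [union_empty] at hFK'
  exact disjoint_left.1 h.disjoint hFK' (h.mem K' hK'.1
    (union_subset (hK'.quasiComponent_subset hxQ (hKK' (Or.inr hxK)))
      (subset_union_left.trans hKK')))

theorem apply_mem [T1Space X] (h : IsAbsorbing F p D) (hF : IsSetSelection F)
    {K : Set X} (hK : IsClosed K) (hKQ : (K ∩ quasiComponent p).Nonempty) : F (D ∪ K) ∈ K :=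
  (hF.mem _ (h.isClopen.1.union hK) (hKQ.mono (inter_subset_left.trans
    subset_union_right))).resolve_left (h.notMem_of_inter_nonempty hF hK hKQ)

theorem apply_pair [T1Space X] (h : IsAbsorbing F p D) (hF : IsSetSelection F)
    {a : X} (b : X) (ha : a ∈ quasiComponent p) : F (D ∪ {a, b}) = a ∨ F (D ∪ {a, b}) = b := by
  have := h.apply_mem hF (toFinite {a, b}).isClosed ⟨a, by simp, ha⟩
  simpa using this

theorem continuous_pair [T1Space X] (h : IsAbsorbing F p D) (hF : IsSetSelection F)
    (z : X) : Continuous fun y => F (D ∪ {z, y}) := by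
  have := hF.continuous_union_singleton (h.isClopen.1.union (isClosed_singleton (x := z)))
  simpa only [union_assoc, singleton_union] using this

theorem isClosed_setOf_pair [T2Space X] (h : IsAbsorbing F p D) (hF : IsSetSelection F)
    (z : X) : IsClosed {y | F (D ∪ {z, y}) = z} :=
  isClosed_eq (h.continuous_pair hF z) continuous_const

theorem isOpen_setOf_pair [T2Space X] (h : IsAbsorbing F p D) (hF : IsSetSelection F)
    {z : X} (hz : z ∉ D) : IsOpen ({y | F (D ∪ {z, y}) = z} \ {z}) := by
  rw [isOpen_iff_mem_nhds]
  rintro y ⟨hy, hyz⟩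
  have hS : IsClosed (D ∪ {z}) := h.isClopen.1.union isClosed_singleton
  have hSz : (D ∪ {z}) \ {z} = D := by simp [hz]
  filter_upwards [isOpen_ne.mem_nhds hyz,
    hF.eventually_eq_of_isolated hS (hSz.symm ▸ h.isClopen.1) hyz (by rw [union_assoc, singleton_union]; exact hy)] with x hxz hx
  rw [union_assoc, singleton_union] at hx
  exact ⟨hx, hxz⟩

/-- For any other value `v`, the set of `y` with `F (D ∪ T ∪ {y}) = v` would be clopen, contain `x`
and miss `F (D ∪ T)`, separating two points of the quasi-component. -/
theorem apply_union_singleton [T2Space X] (h : IsAbsorbing F p D) (hF : IsSetSelection F)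
    {T : Set X} (hT : T.Finite) (hne : T.Nonempty) (hTQ : T ⊆ quasiComponent p) {x : X}
    (hx : x ∈ quasiComponent p) :
    F (D ∪ T ∪ {x}) = x ∨ F (D ∪ T ∪ {x}) = F (D ∪ T) := by
  have hc : IsClosed (D ∪ T) := h.isClopen.1.union hT.isClosed
  by_contra! hcon
  obtain ⟨hvx, hvr⟩ := hcon
  set v := F (D ∪ T ∪ {x}) with hv
  obtain ⟨t, ht⟩ := hne
  have hvT : v ∈ T := by
    have := h.apply_mem hF (K := T ∪ {x}) (hT.isClosed.union isClosed_singleton)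
      ⟨t, Or.inl ht, hTQ ht⟩
    rw [← union_assoc] at this
    exact this.resolve_right hvx
  have hvD : v ∉ D := fun hvD => disjoint_left.1 h.disjoint hvD (hTQ hvT)
  have hrT : F (D ∪ T) ∈ T := h.apply_mem hF hT.isClosed ⟨t, ht, hTQ ht⟩
  have hclopen : IsClopen {y | F (D ∪ T ∪ {y}) = v} := by
    refine ⟨isClosed_eq (hF.continuous_union_singleton hc) continuous_const, ?_⟩
    rw [isOpen_iff_mem_nhds]
    intro y hy
    refine hF.eventually_eq_of_isolated hc ?_ ?_ hy
    · rw [union_sdiff_distrib, sdiff_singleton_eq_self hvD]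
      exact h.isClopen.1.union (hT.subset sdiff_subset).isClosed
    · rintro rfl
      rw [mem_ofPred_eq, union_eq_self_of_subset_right (singleton_subset_iff.2 (mem_union_right _ hvT))] at hy
      exact hvr hy.symm
  have hr := hclopen.quasiComponent_subset hx hv.symm (hTQ hrT)
  rw [mem_ofPred_eq, union_eq_self_of_subset_right (singleton_subset_iff.2 (mem_union_right _ hrT))] at hr
  exact hvr hr.symm

/-- Deleting a point other than `r` and `a` cannot change the selected point `r`, by
`apply_union_singleton`. -/
theorem apply_pair_of_finset [T2Space X] (h : IsAbsorbing F p D) (hF : IsSetSelection F)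
    (T : Finset X) : (T : Set X) ⊆ quasiComponent p → ∀ r ∈ T, F (D ∪ T) = r → ∀ a ∈ T,
    F (D ∪ {r, a}) = r := by
  classical
  induction T using Finset.strongInduction with
  | H T ih =>
  intro hT r hr hFr a ha
  by_cases hb : ∃ b ∈ T, b ≠ r ∧ b ≠ a
  · obtain ⟨b, hb, hbr, hba⟩ := hb
    have hsub : ((T.erase b : Finset X) : Set X) ⊆ quasiComponent p :=
      (Finset.coe_subset.2 (T.erase_subset b)).trans hT
    have hrb : r ∈ T.erase b := Finset.mem_erase.2 ⟨hbr.symm, hr⟩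
    refine ih (T.erase b) (Finset.erase_ssubset hb) hsub r hrb ?_ a
      (Finset.mem_erase.2 ⟨hba.symm, ha⟩)
    have := h.apply_union_singleton hF (T.erase b).finite_toSet ⟨r, hrb⟩ hsub (hT hb)
    rw [union_assoc, union_singleton, ← Finset.coe_insert, Finset.insert_erase hb, hFr] at this
    exact (this.resolve_left hbr.symm).symm
  · push Not at hb
    have : (T : Set X) = {r, a} := by
      ext x
      simp only [Finset.mem_coe, mem_insert_iff, mem_singleton_iff]
      constructor
      · intro hx
        by_cases hxr : x = r
        · exact Or.inl hxr
        · exact Or.inr (hb x hx hxr)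
      · rintro (rfl | rfl) <;> assumption
    rwa [← this]

/-- The point selected from `D` and the quasi-component is minimal for the relation
`F (D ∪ {a, b}) = a` on the quasi-component. -/
theorem apply_pair_apply [T2Space X] (h : IsAbsorbing F p D) (hF : IsSetSelection F)
    {a : X} (ha : a ∈ quasiComponent p) :
    F (D ∪ {F (D ∪ quasiComponent p), a}) = F (D ∪ quasiComponent p) := by
  by_contra hn
  have hO : IsOpen {y | F (D ∪ {y, a}) ≠ y} := by
    have := h.continuous_pair hF a
    simp only [pair_comm a] at this
    exact (isClosed_eq this continuous_id).isOpen_compl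
  have hQ := isClosed_quasiComponent p
  obtain ⟨T, hT, hTS, hTF⟩ := hF.exists_finite (h.isClopen.1.union hQ) ⟨a, Or.inr ha⟩ hO hn
  have hfin : (insert a (T ∩ quasiComponent p)).Finite := (hT.subset inter_subset_left).insert a
  have hsub : insert a (T ∩ quasiComponent p) ⊆ quasiComponent p :=
    insert_subset ha inter_subset_right
  have hTF' := hTF (D ∪ insert a (T ∩ quasiComponent p)) (h.isClopen.1.union hfin.isClosed)
    (fun x hx => (hTS hx).imp_right fun hxQ => Or.inr ⟨hx, hxQ⟩)
    (union_subset_union_right _ hsub) ⟨a, Or.inr (mem_insert _ _)⟩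
  -- On finite sets minimality is `apply_pair_of_finset`; the failure at `a` is an open condition on
  -- the selected point, so it would pass to a finite approximation.
  refine hTF' ?_
  have := h.apply_pair_of_finset hF hfin.toFinset (by rwa [hfin.coe_toFinset])
    (F (D ∪ insert a (T ∩ quasiComponent p)))
    (by
      rw [hfin.mem_toFinset]
      exact h.apply_mem hF hfin.isClosed ⟨a, mem_insert _ _, ha⟩)
    (by rw [hfin.coe_toFinset]) a (by simp)
  exact this

theorem apply_quasiComponent_mem [T1Space X] (h : IsAbsorbing F p D) (hF : IsSetSelection F) :
    F (D ∪ quasiComponent p) ∈ quasiComponent p :=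
  h.apply_mem hF (isClosed_quasiComponent p)
    ⟨p, mem_quasiComponent_self p, mem_quasiComponent_self p⟩

/-- The points that lose to both `x` and `z` under `D` and `D'` form a closed set. It excludes `x`
by `h₁` and `z` by `h₁'`, the only places where openness could fail, so it is clopen and separates
`p` from `x`. -/
theorem false_of_reversed [T2Space X] (h : IsAbsorbing F p D) (h' : IsAbsorbing F p D')
    (hF : IsSetSelection F) {x z : X} (hx : x ∈ quasiComponent p) (hz : z ∈ quasiComponent p)
    (hxz : x ≠ z) (h₁ : F (D ∪ {x, z}) = x) (h₂ : F (D ∪ {x, p}) = x) (h₃ : F (D ∪ {z, p}) = z)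
    (h₁' : F (D' ∪ {z, x}) = z) (h₂' : F (D' ∪ {x, p}) = x) (h₃' : F (D' ∪ {z, p}) = z) :
    False := by
  set I : Set X := {y | F (D ∪ {x, y}) = x} ∩ {y | F (D ∪ {z, y}) = z} ∩
    ({y | F (D' ∪ {x, y}) = x} ∩ {y | F (D' ∪ {z, y}) = z}) with hI
  have hxI : x ∉ I := fun hxI => hxz (by
    have := hxI.1.2
    rw [mem_ofPred_eq, pair_comm] at this
    rw [← h₁, this])
  have hzI : z ∉ I := fun hzI => hxz (by
    have := hzI.2.1
    rw [mem_ofPred_eq, pair_comm] at this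
    rw [← h₁', this])
  have hopen : I = (({y | F (D ∪ {x, y}) = x} \ {x}) ∩ ({y | F (D ∪ {z, y}) = z} \ {z})) ∩
      (({y | F (D' ∪ {x, y}) = x} \ {x}) ∩ ({y | F (D' ∪ {z, y}) = z} \ {z})) := by
    ext y
    constructor
    · intro hy
      have h1 : y ≠ x := fun h => hxI (h ▸ hy)
      have h2 : y ≠ z := fun h => hzI (h ▸ hy)
      exact ⟨⟨⟨hy.1.1, h1⟩, ⟨hy.1.2, h2⟩⟩, ⟨⟨hy.2.1, h1⟩, ⟨hy.2.2, h2⟩⟩⟩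
    · rintro hy
      exact ⟨⟨hy.1.1.1, hy.1.2.1⟩, ⟨hy.2.1.1, hy.2.2.1⟩⟩
  have hD {D : Set X} (h : IsAbsorbing F p D) {x : X} (hx : x ∈ quasiComponent p) : x ∉ D :=
    fun hxD => disjoint_left.1 h.disjoint hxD hx
  have hclopen : IsClopen I := by
    refine ⟨((h.isClosed_setOf_pair hF x).inter (h.isClosed_setOf_pair hF z)).inter
      ((h'.isClosed_setOf_pair hF x).inter (h'.isClosed_setOf_pair hF z)), ?_⟩
    rw [hopen]
    exact ((h.isOpen_setOf_pair hF (hD h hx)).inter (h.isOpen_setOf_pair hF (hD h hz))).inter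
      ((h'.isOpen_setOf_pair hF (hD h' hx)).inter (h'.isOpen_setOf_pair hF (hD h' hz)))
  exact hxI (hx I hclopen ⟨⟨h₂, h₃⟩, ⟨h₂', h₃'⟩⟩)

end IsAbsorbing

/-! ### The cut forces a trivial quasi-component. -/

/-- Disjoint open sets `U`, `V` covering the complement of `p` and both accumulating at `p`. -/
structure IsCut {X : Type*} [TopologicalSpace X] (p : X) (U V : Set X) : Prop where
  isOpen_left : IsOpen U
  isOpen_right : IsOpen V
  disjoint : Disjoint U V
  union_eq : U ∪ V = {p}ᶜ
  mem_closure_left : p ∈ closure U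
  mem_closure_right : p ∈ closure V

section Cut

variable {X : Type*} [TopologicalSpace X] {F : Set X → X} {p : X} {D D' U V : Set X}

theorem IsCutPoint.exists_isCut (h : IsCutPoint p) : ∃ U V : Set X, IsCut p U V := by
  obtain ⟨U, V, hUV, hcl⟩ := h
  have hp : p ∈ closure U ∩ closure V := hcl ▸ rfl
  have key {U V : Set X} (hUV : ({p}ᶜ : Set X) = U ∪ V) (hcl : closure U ∩ closure V = {p}) :
      U = (closure V)ᶜ := by
    have hpU : p ∉ U := fun h => absurd (hUV.symm ▸ Or.inl h : p ∈ ({p}ᶜ : Set X)) (by simp)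
    have hp : p ∈ closure U ∩ closure V := hcl ▸ rfl
    ext x
    constructor
    · intro hx hxV
      obtain rfl : x = p := hcl.subset ⟨subset_closure hx, hxV⟩
      exact hpU hx
    · intro hx
      have hxp : x ∈ ({p}ᶜ : Set X) := by
        rintro rfl
        exact hx hp.2
      rw [hUV] at hxp
      exact hxp.resolve_right fun h => hx (subset_closure h)
  have hU := key hUV hcl
  have hV := key (hUV.trans (union_comm U V)) ((inter_comm _ _).trans hcl)
  refine ⟨U, V, ?_, ?_, ?_, hUV.symm, hp.1, hp.2⟩
  · rw [hU]
    exact isClosed_closure.isOpen_compl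
  · rw [hV]
    exact isClosed_closure.isOpen_compl
  · rw [hU]
    exact disjoint_compl_left_iff_subset.2 subset_closure

namespace IsCut

theorem symm (h : IsCut p U V) : IsCut p V U :=
  ⟨h.isOpen_right, h.isOpen_left, h.disjoint.symm, (union_comm _ _).trans h.union_eq,
    h.mem_closure_right, h.mem_closure_left⟩

theorem notMem_left (h : IsCut p U V) : p ∉ U := fun hp =>
  absurd (h.union_eq.subset (Or.inl hp)) (by simp)

theorem mem_or_mem (h : IsCut p U V) {x : X} (hx : x ≠ p) : x ∈ U ∨ x ∈ V :=
  h.union_eq.symm.subset hx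

theorem compl_left (h : IsCut p U V) : Uᶜ = V ∪ {p} := by
  ext x
  constructor
  · intro hx
    by_cases hxp : x = p
    · exact Or.inr hxp
    · exact Or.inl ((h.mem_or_mem hxp).resolve_left hx)
  · rintro (hx | rfl)
    · exact disjoint_right.1 h.disjoint hx
    · exact h.notMem_left

theorem isClosed_union_singleton (h : IsCut p U V) : IsClosed (V ∪ {p}) := by
  rw [← h.compl_left]
  exact h.isOpen_left.isClosed_compl

/-- A point of one side of the cut does not separate the other side from `p` on the
quasi-component. -/
theorem apply_pair_iff [T2Space X] (h : IsCut p U V) (hD : IsAbsorbing F p D)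
    (hF : IsSetSelection F) {z y : X} (hz : z ∈ quasiComponent p) (hzU : z ∈ U)
    (hy : y ∈ quasiComponent p) (hyV : y ∈ V) :
    F (D ∪ {z, y}) = z ↔ F (D ∪ {z, p}) = z := by
  set A : Set X := {y | F (D ∪ {z, y}) = z} with hA
  have hAc : IsClosed A := hD.isClosed_setOf_pair hF z
  have hAo : IsOpen (A \ {z}) := hD.isOpen_setOf_pair hF
    fun hzD => disjoint_left.1 hD.disjoint hzD hz
  have hzV : z ∉ V := disjoint_left.1 h.disjoint hzU
  have hzp : z ≠ p := fun hzp => h.notMem_left (hzp ▸ hzU)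
  have hVz : V ∩ (A \ {z}) = V ∩ A := by
    ext x
    refine ⟨fun hx => ⟨hx.1, hx.2.1⟩, fun hx => ⟨hx.1, hx.2, ?_⟩⟩
    rintro rfl
    exact hzV hx.1
  change y ∈ A ↔ p ∈ A
  -- `A` is clopen except possibly at `z ∉ V`, so whichever of `V \ A` and `V ∩ A` does not
  -- accumulate at `p` is clopen, misses `p`, and hence misses the quasi-component.
  by_cases hpA : p ∈ A
  · refine iff_of_true (by_contra fun hyA => ?_) hpA
    have hE : IsClopen (V \ A) := by
      constructor
      · have : V \ A = (V ∪ {p}) \ (A \ {z}) := by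
          ext x
          constructor
          · rintro ⟨hxV, hxA⟩
            exact ⟨Or.inl hxV, fun hx => hxA hx.1⟩
          · rintro ⟨hxV | rfl, hxA⟩
            · exact ⟨hxV, fun hx => hxA ⟨hx, fun hxz => hzV (hxz ▸ hxV)⟩⟩
            · exact absurd ⟨hpA, hzp.symm⟩ hxA
        rw [this]
        exact h.isClosed_union_singleton.sdiff hAo
      · exact h.isOpen_right.sdiff hAc
    exact disjoint_left.1 (hE.disjoint_quasiComponent fun hp => hp.2 hpA) ⟨hyV, hyA⟩ hy
  · refine iff_of_false (fun hyA => ?_) hpA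
    have hE : IsClopen (V ∩ A) := by
      constructor
      · have : V ∩ A = (V ∪ {p}) ∩ A := by
          ext x
          refine ⟨fun hx => ⟨Or.inl hx.1, hx.2⟩, ?_⟩
          rintro ⟨hxV | rfl, hxA⟩
          · exact ⟨hxV, hxA⟩
          · exact absurd hxA hpA
        rw [this]
        exact h.isClosed_union_singleton.inter hAc
      · rw [← hVz]
        exact h.isOpen_right.inter hAo
    exact disjoint_left.1 (hE.disjoint_quasiComponent fun hp => hpA hp.2) ⟨hyV, hyA⟩ hy

/-- Each `y ∈ V` loses to `z`, since a win would persist on a clopen set containing `D` and the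
quasi-component; let `y` tend to `p`. -/
theorem apply_pair_of_disjoint [T2Space X] (h : IsCut p U V) (hD : IsAbsorbing F p D)
    (hF : IsSetSelection F) (hV : Disjoint V (quasiComponent p)) {z : X}
    (hz : z ∈ quasiComponent p) : F (D ∪ {z, p}) = z := by
  refine closure_minimal (fun y hy => ?_) (hD.isClosed_setOf_pair hF z) h.mem_closure_right
  obtain ⟨E, hE, hpE, hyE⟩ := exists_isClopen_of_notMem_quasiComponent (disjoint_left.1 hV hy)
  refine (hD.apply_pair hF y hz).resolve_right fun hFy => ?_
  obtain ⟨K', hK', hKK', -, hFK'⟩ := hF.exists_isClopen isClopen_univ hE isClosed_empty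
    (hD.isClopen.1.union (toFinite {z, y}).isClosed) (subset_univ _)
    (by rw [union_empty, hFy]; exact hyE)
  rw [union_empty] at hFK'
  exact disjoint_left.1 (hE.disjoint_quasiComponent hpE) hFK' (hD.mem K' hK'.1
    (union_subset (hK'.quasiComponent_subset hz (hKK' (by simp)))
      (subset_union_left.trans hKK')))

/-- Any `w ∈ V` of the quasi-component loses to the minimum in `U`, hence to `p`-side comparisons
with all of `U`; so `z` beats `w`, and therefore `p`. -/
theorem apply_pair_of_mem_left [T2Space X] (h : IsCut p U V) (hD : IsAbsorbing F p D)
    (hF : IsSetSelection F) (hm : F (D ∪ quasiComponent p) ∈ U) {z : X}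
    (hz : z ∈ quasiComponent p) (hzU : z ∈ U) : F (D ∪ {z, p}) = z := by
  by_cases hV : Disjoint V (quasiComponent p)
  · exact h.apply_pair_of_disjoint hD hF hV hz
  obtain ⟨w, hwV, hw⟩ := not_disjoint_iff.1 hV
  have hne {x : X} (hx : x ∈ U) : x ≠ w := fun hxw => disjoint_left.1 h.disjoint hx (hxw ▸ hwV)
  have hmQ := hD.apply_quasiComponent_mem hF
  have h1 := hD.apply_pair_apply hF hw
  have h2 : F (D ∪ {w, p}) ≠ w := fun h2 => by
    have := (h.symm.apply_pair_iff hD hF hw hwV hmQ hm).2 h2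
    rw [pair_comm, h1] at this
    exact hne hm this
  have h3 : F (D ∪ {w, z}) ≠ w := fun h3 => h2 ((h.symm.apply_pair_iff hD hF hw hwV hz hzU).1 h3)
  have h4 := (hD.apply_pair hF z hw).resolve_left h3
  rw [pair_comm] at h4
  exact (h.apply_pair_iff hD hF hz hzU hw hwV).1 h4

theorem apply_quasiComponent_ne_of_mem_left [T2Space X] (h : IsCut p U V)
    (hD : IsAbsorbing F p D) (hF : IsSetSelection F) {q : X} (hq : q ∈ quasiComponent p)
    (hqU : q ∈ U) : F (D ∪ quasiComponent p) ≠ p := by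
  intro hm
  have hmin {a : X} (ha : a ∈ quasiComponent p) : F (D ∪ {a, p}) = p := by
    have := hD.apply_pair_apply hF ha
    rwa [hm, pair_comm] at this
  have hne {x : X} (hx : x ∈ U ∪ V) : p ≠ x := fun hpx => h.union_eq.subset hx hpx.symm
  by_cases hV : Disjoint V (quasiComponent p)
  · have := h.apply_pair_of_disjoint hD hF hV hq
    exact hne (Or.inl hqU) ((hmin hq).symm.trans this)
  obtain ⟨w, hwV, hw⟩ := not_disjoint_iff.1 hV
  rcases hD.apply_pair hF w hq with hqw | hqw
  · exact hne (Or.inl hqU)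
      ((hmin hq).symm.trans ((h.apply_pair_iff hD hF hq hqU hw hwV).1 hqw))
  · rw [pair_comm] at hqw
    exact hne (Or.inr hwV)
      ((hmin hw).symm.trans ((h.symm.apply_pair_iff hD hF hw hwV hq hqU).1 hqw))

theorem apply_quasiComponent_ne [T2Space X] (h : IsCut p U V) (hD : IsAbsorbing F p D)
    (hF : IsSetSelection F) {q : X} (hq : q ∈ quasiComponent p) (hqp : q ≠ p) :
    F (D ∪ quasiComponent p) ≠ p := by
  rcases h.mem_or_mem hqp with hqU | hqV
  · exact h.apply_quasiComponent_ne_of_mem_left hD hF hq hqU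
  · exact h.symm.apply_quasiComponent_ne_of_mem_left hD hF hq hqV

theorem apply_quasiComponent_eq [T2Space X] (h : IsCut p U V) (hD : IsAbsorbing F p D)
    (hD' : IsAbsorbing F p D') (hF : IsSetSelection F) (hm : F (D ∪ quasiComponent p) ∈ U)
    (hm' : F (D' ∪ quasiComponent p) ∈ U) :
    F (D ∪ quasiComponent p) = F (D' ∪ quasiComponent p) := by
  by_contra hne
  have hmQ := hD.apply_quasiComponent_mem hF
  have hmQ' := hD'.apply_quasiComponent_mem hF
  exact hD.false_of_reversed hD' hF hmQ hmQ' hne (hD.apply_pair_apply hF hmQ')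
    (h.apply_pair_of_mem_left hD hF hm hmQ hm) (h.apply_pair_of_mem_left hD hF hm hmQ' hm')
    (hD'.apply_pair_apply hF hmQ) (h.apply_pair_of_mem_left hD' hF hm' hmQ hm)
    (h.apply_pair_of_mem_left hD' hF hm' hmQ' hm')

theorem exists_isAbsorbing_apply_mem [T2Space X] (hD : IsAbsorbing F p D) (hF : IsSetSelection F)
    (hp : F univ = p) {O : Set X} (hO : IsOpen O) (hpO : p ∈ O) :
    ∃ D', IsAbsorbing F p D' ∧ F (D' ∪ quasiComponent p) ∈ O := by
  obtain ⟨T, hT, hTF⟩ := hF.exists_finite_of_univ hp hO hpO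
  obtain ⟨D', hD', hpD', hDD', hTD'⟩ := exists_isClopen_union_finite hD.isClopen hD.notMem hT
  refine ⟨D', hD.mono hD' hpD' hDD', hTF _ (hD'.1.union (isClosed_quasiComponent p)) ?_
    ⟨p, Or.inr (mem_quasiComponent_self p)⟩⟩
  rwa [union_comm]

/-- Pigeonhole: three absorbing sets with distinct minima, all different from `p`, would put two
minima on one side of the cut. -/
theorem quasiComponent_eq_singleton [T2Space X] (h : IsCut p U V) (hD : IsAbsorbing F p D)
    (hF : IsSetSelection F) (hp : F univ = p) : quasiComponent p = {p} := by
  refine Subset.antisymm (fun q hq => by_contra fun hqp => ?_)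
    (singleton_subset_iff.2 (mem_quasiComponent_self p))
  have hne {D : Set X} (hD : IsAbsorbing F p D) : F (D ∪ quasiComponent p) ≠ p :=
    h.apply_quasiComponent_ne hD hF hq hqp
  obtain ⟨D₁, hD₁, h₁⟩ := exists_isAbsorbing_apply_mem hD hF hp
    (isOpen_compl_singleton (x := F (D ∪ quasiComponent p))) (hne hD).symm
  obtain ⟨D₂, hD₂, h₂⟩ := exists_isAbsorbing_apply_mem hD hF hp
    ((isOpen_compl_singleton (x := F (D ∪ quasiComponent p))).inter
      (isOpen_compl_singleton (x := F (D₁ ∪ quasiComponent p)))) ⟨(hne hD).symm, (hne hD₁).symm⟩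
  have hU {D D' : Set X} (hD : IsAbsorbing F p D) (hD' : IsAbsorbing F p D') :=
    h.apply_quasiComponent_eq hD hD' hF
  have hV {D D' : Set X} (hD : IsAbsorbing F p D) (hD' : IsAbsorbing F p D') :=
    h.symm.apply_quasiComponent_eq hD hD' hF
  rcases h.mem_or_mem (hne hD) with h0 | h0 <;> rcases h.mem_or_mem (hne hD₁) with h1 | h1 <;>
    rcases h.mem_or_mem (hne hD₂) with h2 | h2
  · exact h₁ (hU hD₁ hD h1 h0)
  · exact h₁ (hU hD₁ hD h1 h0)
  · exact h₂.1 (hU hD₂ hD h2 h0)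
  · exact h₂.2 (hV hD₂ hD₁ h2 h1)
  · exact h₂.2 (hU hD₂ hD₁ h2 h1)
  · exact h₂.1 (hV hD₂ hD h2 h0)
  · exact h₁ (hV hD₁ hD h1 h0)
  · exact h₁ (hV hD₁ hD h1 h0)

end IsCut

end Cut

/-! ### Trivial quasi-component: the alternating sequence. -/

section TotallyDisconnectedAt

variable {X : Type*} [TopologicalSpace X] {F : Set X → X} {p : X} {D U V : Set X}

/-- `F` sends `closure (S ∪ U)` to `p`, so nearby sets `S ∪ E ∩ U` have values outside the closed
set `S ∩ V`, hence in `U`. -/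
theorem IsCut.exists_isClopen_apply_mem (h : IsCut p U V) (hD : IsAbsorbing F p D)
    (hF : IsSetSelection F) (hQ : quasiComponent p = {p}) {S : Set X} (hS : IsClopen S)
    (hpS : p ∉ S) (hDS : D ⊆ S) : ∃ S', IsClopen S' ∧ p ∉ S' ∧ S ⊆ S' ∧ F S' ∈ U := by
  obtain ⟨u, hu⟩ : U.Nonempty := closure_nonempty_iff.1 ⟨p, h.mem_closure_left⟩
  have hSV : S ∩ V = S ∩ Uᶜ := by
    rw [h.compl_left, inter_union_distrib_left, inter_singleton_eq_empty.2 hpS, union_empty]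
  have hO : IsOpen (S ∩ V)ᶜ := by
    rw [hSV]
    exact (hS.1.inter h.isOpen_left.isClosed_compl).isOpen_compl
  have hp : F (closure (S ∪ U)) = p := hD.apply_eq hQ isClosed_closure
    (hDS.trans (subset_union_left.trans subset_closure))
    (closure_mono subset_union_right h.mem_closure_left)
  obtain ⟨T, hT, hTM, hTF⟩ := hF.exists_finite_of_closure (M := S ∪ U) ⟨u, Or.inr hu⟩ hO
    (by rw [hp]; exact fun h => hpS h.1)
  have hdisj : Disjoint (insert u T) (quasiComponent p) := by
    rw [hQ, disjoint_singleton_right]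
    intro hp
    rcases insert_subset (mem_union_right S hu) hTM hp with hp | hp
    · exact hpS hp
    · exact h.notMem_left hp
  obtain ⟨E, hE, hpE, hTE⟩ := exists_isClopen_of_finite (hT.insert u) hdisj
  have hEU : IsClopen (E ∩ U) := by
    refine ⟨?_, hE.2.inter h.isOpen_left⟩
    have : E ∩ U = E ∩ Vᶜ := by
      rw [h.symm.compl_left, inter_union_distrib_left, inter_singleton_eq_empty.2 hpE, union_empty]
    rw [this]
    exact hE.1.inter h.isOpen_right.isClosed_compl
  have hK := hS.union hEU
  have hne : (S ∪ E ∩ U).Nonempty := ⟨u, Or.inr ⟨hTE (mem_insert _ _), hu⟩⟩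
  refine ⟨S ∪ E ∩ U, hK, fun hp => hp.elim hpS fun hp => hpE hp.1, subset_union_left, ?_⟩
  have hFO := hTF _ hK.1 (fun t ht => (hTM ht).imp_right
    fun htU => ⟨hTE (mem_insert_of_mem _ ht), htU⟩)
    ((union_subset_union_right _ inter_subset_right).trans subset_closure) hne
  rcases hF.mem _ hK.1 hne with hFS | hFU
  · by_contra hn
    rw [hSV] at hFO
    exact hFO ⟨hFS, hn⟩
  · exact hFU.2

/-- Absorption gives `F (S ∪ {p}) = p`, so the clopen set of `isClopen_setOf_eq` contains `p`; it
meets `U`, and a clopen piece missing `p` is cut out. -/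
theorem IsCut.exists_isClopen_apply_eq [T2Space X] (h : IsCut p U V) (hD : IsAbsorbing F p D)
    (hF : IsSetSelection F) (hQ : quasiComponent p = {p}) {S : Set X} (hS : IsClopen S)
    (hpS : p ∉ S) (hDS : D ⊆ S) (hne : S.Nonempty) :
    ∃ L, IsClopen L ∧ L.Nonempty ∧ p ∉ L ∧ ∀ y ∈ L, F (S ∪ {y}) = y := by
  have hW := hF.isClopen_setOf_eq hS.1 hS.compl (not_not.2 (hF.mem S hS.1 hne))
  obtain ⟨y, hyW, hyU⟩ := mem_closure_iff.1 h.mem_closure_left _ hW.2 ⟨hpS,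
    hD.apply_eq hQ (hS.1.union isClosed_singleton) (hDS.trans subset_union_left) (by simp)⟩
  obtain ⟨E, hE, hpE, hyE⟩ := exists_isClopen_of_notMem_quasiComponent (p := p) (x := y) (by
    rw [hQ]
    rintro rfl
    exact h.notMem_left hyU)
  exact ⟨_, hW.inter hE, ⟨y, hyW, hyE⟩, fun hp => hpE hp.2, fun y hy => hy.1.2⟩

theorem IsCut.isClopenLimit_of_quasiComponent_eq [T2Space X]
    (h : IsCut p U V) (hD : IsAbsorbing F p D)
    (hF : IsSetSelection F) (hQ : quasiComponent p = {p}) : IsClopenLimit p := by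
  let Good : Set X → Prop := fun S => IsClopen S ∧ p ∉ S ∧ D ⊆ S ∧ S.Nonempty
  have step (S : {S // Good S}) : ∃ (S' : {S // Good S}) (L M : Set X),
      (IsClopen L ∧ L.Nonempty ∧ p ∉ L) ∧ (∀ y ∈ L, F (S.1 ∪ {y}) = y) ∧ IsClosed M ∧
      S.1 ∪ L ⊆ M ∧ M ⊆ S'.1 ∧ F M ∈ U ∧ F S'.1 ∈ V := by
    obtain ⟨S, hS, hpS, hDS, hne⟩ := S
    obtain ⟨L, hL, hLne, hpL, hLF⟩ := h.exists_isClopen_apply_eq hD hF hQ hS hpS hDS hne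
    obtain ⟨M, hM, hpM, hSM, hFM⟩ := h.exists_isClopen_apply_mem hD hF hQ (hS.union hL)
      (by simp [hpS, hpL]) (hDS.trans subset_union_left)
    have hDM : D ⊆ M := hDS.trans (subset_union_left.trans hSM)
    obtain ⟨S', hS', hpS', hMS', hFS'⟩ := h.symm.exists_isClopen_apply_mem hD hF hQ hM hpM hDM
    exact ⟨⟨S', hS', hpS', hDM.trans hMS',
      hne.mono ((subset_union_left.trans hSM).trans hMS')⟩, L, M, ⟨hL, hLne, hpL⟩, hLF, hM.1,
      hSM, hMS', hFM, hFS'⟩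
  choose next L M hL hLF hM hSM hMS hMU hSV using step
  obtain ⟨u, hu⟩ : (U : Set X).Nonempty := closure_nonempty_iff.1 ⟨p, h.mem_closure_left⟩
  obtain ⟨E, hE, hpE, huE⟩ := exists_isClopen_of_notMem_quasiComponent (p := p) (x := u) (by
    rw [hQ]
    rintro rfl
    exact h.notMem_left hu)
  let S₀ : {S // Good S} := ⟨D ∪ E, hD.isClopen.union hE, by simp [hD.notMem, hpE],
    subset_union_left, ⟨u, Or.inr huE⟩⟩
  let S : ℕ → {S // Good S} := fun n => next^[n] S₀
  have hsucc (n : ℕ) : S (n + 1) = next (S n) := Function.iterate_succ_apply' next n S₀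
  have hmono : Monotone fun n => (S n).1 := monotone_nat_of_le_succ fun n => by
    rw [hsucc]
    exact (subset_union_left.trans (hSM (S n))).trans (hMS (S n))
  set S' : Set X := closure (⋃ n, (S n).1) with hS'
  have hsub (n : ℕ) : (S n).1 ⊆ S' := (subset_iUnion (fun n => (S n).1) n).trans subset_closure
  have hMsub (n : ℕ) : M (S n) ⊆ S' := by
    refine (hMS (S n)).trans ?_
    rw [← hsucc]
    exact hsub (n + 1)
  have hSne (n : ℕ) : ((S n).1).Nonempty := (S n).2.2.2.2
  have hne : (⋃ n, (S n).1).Nonempty := (hSne 0).mono (subset_iUnion (fun n => (S n).1) 0)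
  have key {O : Set X} (hO : IsOpen O) (hFO : F S' ∈ O) :
      ∃ N, ∀ n ≥ N, ∀ K, IsClosed K → (S n).1 ⊆ K → K ⊆ S' → F K ∈ O := by
    obtain ⟨T, hT, hTS, hTF⟩ := hF.exists_finite_of_closure hne hO hFO
    obtain ⟨N, hN⟩ := hmono.directed_le.exists_mem_subset_of_finset_subset_biUnion
      (s := hT.toFinset) (by simpa using hTS)
    refine ⟨N, fun n hn K hK hSK hKS => hTF K hK ?_ hKS ((hSne n).mono hSK)⟩
    have hTN : T ⊆ (S N).1 := by simpa using hN
    exact hTN.trans ((hmono hn).trans hSK)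
  -- A value in `U` or `V` would contradict the alternation `F (M (S n)) ∈ U`, `F (S (n + 1)) ∈ V`
  -- near the limit.
  have hFS' : F S' = p := by
    by_contra hne
    rcases h.mem_or_mem hne with hU | hV
    · obtain ⟨N, hN⟩ := key h.isOpen_left hU
      have := hN (N + 1) (Nat.le_succ N) _ (S (N + 1)).2.1.1 subset_rfl (hsub _)
      rw [hsucc] at this
      exact disjoint_left.1 h.disjoint this (hSV _)
    · obtain ⟨N, hN⟩ := key h.isOpen_right hV
      exact disjoint_left.1 h.disjoint (hMU (S N)) (hN N le_rfl _ (hM _)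
        (subset_union_left.trans (hSM _)) (hMsub N))
  refine ⟨fun n => L (S n), fun n => hL _, fun O hO hpO => ?_⟩
  obtain ⟨N, hN⟩ := key hO (by rwa [hFS'])
  filter_upwards [Filter.eventually_ge_atTop N] with n hn y hy
  rw [← hLF (S n) y hy]
  refine hN n hn _ ((S n).2.1.1.union isClosed_singleton) subset_union_left (union_subset (hsub n)
    (singleton_subset_iff.2 (hMsub n (hSM _ (Or.inr hy)))))

end TotallyDisconnectedAt

theorem IsSetSelection.isClopenLimit_of_isCutPoint {X : Type*} [TopologicalSpace X] [T2Space X]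
    {F : Set X → X} {p : X} (hF : IsSetSelection F) (hp : F univ = p) (hcut : IsCutPoint p) :
    IsClopenLimit p := by
  obtain ⟨U, V, h⟩ := hcut.exists_isCut
  by_cases hbad : ∃ D, IsClopen D ∧ p ∉ D ∧ ∀ D', IsClopen D' → p ∉ D' → Disjoint D D' →
      ∀ y ∈ D', F (D'ᶜ ∪ {y}) ≠ y
  · obtain ⟨D, hD, hpD, hbad⟩ := hbad
    obtain ⟨D₁, hD₁, hpD₁, hFD₁⟩ := hF.exists_forall_mem_quasiComponent hp hD hpD hbad
    have habs : IsAbsorbing F p D₁ := ⟨hD₁, hpD₁, hFD₁⟩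
    exact h.isClopenLimit_of_quasiComponent_eq habs hF
      (h.quasiComponent_eq_singleton habs hF hp)
  · push Not at hbad
    exact hF.isClopenLimit_of_forall_exists hp fun D hD hpD => hbad D hD hpD

theorem theorem1p1 (X : Type*) [TopologicalSpace X] [T2Space X] [Nonempty X]
    (hsel : ∃ f : VietorisHyperspace X → X, IsContinuousSelection f) :
    countablyApproachablePoints X =
        {p ∈ selectionPoints X | IsIsolatedPoint p ∨ IsCutPoint p} ∧
      ∀ p ∈ selectionPoints X, IsCutPoint p → IsOmegaApproachable p := by
  have hcut : ∀ p ∈ selectionPoints X, IsCutPoint p → IsOmegaApproachable p := by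
    rintro p ⟨f, hf, hfp⟩ hp
    obtain ⟨F, hF, hFf⟩ := hf.exists_isSetSelection
    exact (hF.isClopenLimit_of_isCutPoint (hFf.trans hfp) hp).isOmegaApproachable
  refine ⟨Subset.antisymm ?_ ?_, hcut⟩
  · obtain ⟨f, hf⟩ := hsel
    obtain ⟨F, hF, -⟩ := hf.exists_isSetSelection
    rintro p (hp | hp)
    · obtain ⟨G, hG, hGp⟩ := hp.exists_isSetSelection hF
      exact ⟨⟨_, hG.isContinuousSelection, hGp⟩, Or.inl hp⟩
    · obtain ⟨G, hG, hGp⟩ := hp.isClopenLimit.exists_isSetSelection hF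
      exact ⟨⟨_, hG.isContinuousSelection, hGp⟩, Or.inr hp.isClopenLimit.isCutPoint⟩
  · rintro p ⟨hp, hp' | hp'⟩
    · exact Or.inl hp'
    · exact Or.inr (hcut p hp hp')
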